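/- A compact space $X$ is called a Corson compactum if, for some cardinal $\kappa$, it is homeomorphic to a subspace of the $\Sigma$-product of lines $\Sigma(\mathbb{R}^\kappa)=\{x\in\mathbb{R}^\kappa : |\{\alpha<\kappa : x(\alpha)\neq 0\}|\leq\aleph_0\}$, equipped with the subspace topology of the product topology. The weight $w(X)$ of a space $X$ is the least cardinality of a base of $X$. A cellular family in a space $Z$ is a family of pairwise disjoint non-empty open subsets of $Z$, and $\hat{c}(Z)$ denotes the least cardinal $\kappa$ such that $Z$ has no cellular family of cardinality $\kappa$. **Theorem.** Let $X$ be a Corson compactum, and let $X^\omega$ be the product of countably infinitely many copies of $X$ with the product topology. Then $X^\omega$ has a dense subspace that is metrizable if and only if $\hat{c}(X^\omega)>w(X)$. -/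

import Mathlib

open TopologicalSpace Cardinal

universe u

/-- The `Σ`-product of lines `Σ(ℝ^ι)`: all points of `ℝ^ι` with countable support, as a subset of
`ι → ℝ` with the product topology. -/
def sigmaProduct (ι : Type u) : Set (ι → ℝ) :=
  {x | (Function.support x).Countable}

/-- A Corson compactum: a compact space that is homeomorphic to a subspace of a `Σ`-product of
lines. (The Hausdorff property follows. Index sets in the universe of `X` suffice: as a family of
functions `X → ℝ`, the coordinates of an embedding are indexed, after removing repetitions, by a
subset of `X → ℝ`.) -/
def IsCorsonCompactum (X : Type u) [TopologicalSpace X] : Prop :=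
  CompactSpace X ∧ ∃ (ι : Type u) (f : X → sigmaProduct ι), Topology.IsEmbedding f

/-- A cellular family: a family of pairwise disjoint non-empty open sets. -/
def IsCellularFamily {X : Type u} [TopologicalSpace X] (C : Set (Set X)) : Prop :=
  (∀ U ∈ C, IsOpen U ∧ U.Nonempty) ∧ C.Pairwise Disjoint

/-- The set of cardinals that are not the cardinality of a cellular family is non-empty, so its
least element below is a genuine one. -/
theorem exists_not_card_cellularFamily (X : Type u) [TopologicalSpace X] :
    {κ : Cardinal.{u} | ¬ ∃ C : Set (Set X), IsCellularFamily C ∧ #C = κ}.Nonempty := by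
  refine ⟨Order.succ #(Set X), ?_⟩
  rintro ⟨C, -, hC⟩
  exact absurd (hC ▸ mk_set_le C) (not_le.2 (Order.lt_succ _))

/-- `ĉ(X)`: the least cardinal `κ` such that `X` has no cellular family of cardinality `κ`. -/
noncomputable def cellularityHat (X : Type u) [TopologicalSpace X] : Cardinal.{u} :=
  sInf {κ : Cardinal.{u} | ¬ ∃ C : Set (Set X), IsCellularFamily C ∧ #C = κ}

/-- The weight `w(X)`: the least cardinality of a base of `X`. -/
noncomputable def weight (X : Type u) [TopologicalSpace X] : Cardinal.{u} :=
  sInf {κ : Cardinal.{u} | ∃ B : Set (Set X), IsTopologicalBasis B ∧ #B = κ}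

/-- `X` has a dense subset that is metrizable in the subspace topology. -/
def HasDenseMetrizableSubspace (X : Type u) [TopologicalSpace X] : Prop :=
  ∃ D : Set X, Dense D ∧ MetrizableSpace D

open Topology Set Filter


/-! Given a dense metrizable `D ⊆ X^ω`, take maximal `1/(n+1)`-separated sets in `D`. Their union
projects to a dense set in `X`, and in a `Σ`-product density bounds weight. Small balls about one
separated set are disjoint, and an extra coordinate of `X^ω` keeps different `n` apart. So one
cellular family has the full size, even if no single separated set does.

Conversely, a cellular family of size `w(X)` (infinite case) can label the boxes `b₀ × … × bₙ₋₁` of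
base sets. Restricting the later coordinates to the label makes boxes of equal length disjoint,
which gives a `σ`-disjoint `π`-base. By Zorn and compactness, points of countable character are
dense. Such points are added in stages: old ones stay with shrinking disjoint neighbourhoods, and
the gaps are filled by new ones whose neighbourhoods decide ever more of the `π`-base. The collected
points are dense, and recording the cell of a point at each stage embeds them in a countable product
of discrete spaces. -/

/-! ### Points of countable character -/

/-- In a compact Hausdorff space with a continuous injection into a `Σ`-product, the points with a
countable neighbourhood base are dense. -/
theorem exists_isCountablyGenerated_nhds_of_sigmaProduct {Y : Type*} [TopologicalSpace Y]
    [CompactSpace Y] [T2Space Y] {ι : Type*} (f : Y → ι → ℝ) (hf : Continuous f)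
    (hinj : Function.Injective f) (hsupp : ∀ y, (Function.support (f y)).Countable)
    {U : Set Y} (hU : IsOpen U) (hne : U.Nonempty) :
    ∃ x ∈ U, (𝓝 x).IsCountablyGenerated := by
  obtain ⟨x₀, hx₀⟩ := hne
  obtain ⟨φ, hφ0, hφ1, -⟩ := exists_continuous_zero_one_of_isClosed hU.isClosed_compl
    (isClosed_singleton (x := x₀)) (by simpa using hx₀)
  have hφx₀ : φ x₀ = 1 := hφ1 rfl
  -- `y` extends `x`. A maximal point is the only one in `φ = 1` with its values on its countable
  -- support.
  let r : {y // φ y = 1} → {y // φ y = 1} → Prop :=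
    fun x y => ∀ a, f x a ≠ 0 → f y a = f x a
  have htrans : ∀ {a b c}, r a b → r b c → r a c := by
    intro a b c hab hbc i hi
    rw [hbc i (by rwa [hab i hi]), hab i hi]
  have : Nonempty {y // φ y = 1} := ⟨⟨x₀, hφx₀⟩⟩
  have hcpt : CompactSpace {y // φ y = 1} :=
    isCompact_iff_compactSpace.1 (isClosed_eq φ.continuous continuous_const).isCompact
  have hclosed : ∀ x, IsClosed {y | r x y} := by
    intro x
    simp only [r, ofPred_forall]
    refine isClosed_iInter fun a => isClosed_iInter fun _ => ?_
    exact isClosed_eq ((continuous_apply a).comp (hf.comp continuous_subtype_val)) continuous_const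
  obtain ⟨m, hm⟩ := exists_maximal_of_nonempty_chains_bounded (r := r) (by
    intro c hc hcne
    have hcne' : Nonempty c := hcne.to_subtype
    obtain ⟨z, hz⟩ := IsCompact.nonempty_iInter_of_directed_nonempty_isCompact_isClosed
      (fun x : c => {y | r x y}) (by
        intro x y
        have hrefl : ∀ a, r a a := fun a i _ => rfl
        by_cases hxy : x.1 = y.1
        · exact ⟨x, subset_rfl, by
            change {z | r x.1 z} ⊆ {z | r y.1 z}
            rw [hxy]⟩
        · rcases hc x.2 y.2 hxy with h | h
          · exact ⟨y, fun z hz => htrans h hz, subset_rfl⟩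
          · exact ⟨x, subset_rfl, fun z hz => htrans h hz⟩)
      (fun x => ⟨x.1, fun i _ => rfl⟩) (fun x => (hclosed x).isCompact) (fun x => hclosed x)
    exact ⟨z, fun a ha => mem_iInter.1 hz ⟨a, ha⟩⟩) htrans
  have hmU : (m : Y) ∈ U := by
    by_contra h
    have := hφ0 (show (m : Y) ∈ Uᶜ from h)
    have h1 := m.2
    simp_all
  refine ⟨m, hmU, ?_⟩
  let S := Function.support (f m)
  have : Countable S := (hsupp m).to_subtype
  let h : Y → ℝ × (S → ℝ) := fun y => (φ y, fun s => f y s)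
  have hh : Continuous h := φ.continuous.prodMk
    (continuous_pi fun s => (continuous_apply s.1).comp hf)
  have hfib : h ⁻¹' {h m} = {(m : Y)} := by
    ext y
    simp only [mem_preimage, mem_singleton_iff]
    refine ⟨fun hy => ?_, fun hy => by rw [hy]⟩
    have h1 : φ y = 1 := (congrArg Prod.fst hy).trans m.2
    have h2 : ∀ a, f m a ≠ 0 → f y a = f m a := fun a ha => congrFun (congrArg Prod.snd hy) ⟨a, ha⟩
    have h3 := hm ⟨y, h1⟩ h2
    apply hinj
    ext a
    by_cases ha : f y a = 0
    · by_contra hne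
      exact hne (h2 a fun h0 => hne (ha.trans h0.symm))
    · exact (h3 a ha).symm
  -- A closed map with fibre `{m}` pulls the neighbourhood filter of `m` back from a first-countable
  -- space.
  have key := hh.isClosedMap.comap_nhds_eq hh (h m)
  rw [hfib, nhdsSet_singleton] at key
  rw [← key]
  infer_instance

/-! ### Weight and cellularity -/

theorem weight_le_mk {X : Type u} [TopologicalSpace X] {B : Set (Set X)}
    (hB : IsTopologicalBasis B) : weight X ≤ #B :=
  csInf_le' (s := {κ : Cardinal.{u} | ∃ B : Set (Set X), IsTopologicalBasis B ∧ #B = κ})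
    ⟨B, hB, rfl⟩

/-- The weight of a subspace of a `Σ`-product is at most its density. -/
theorem weight_le_of_denseRange {X ι T : Type u} [TopologicalSpace X] [Infinite T]
    (f : X → sigmaProduct ι) (hf : IsEmbedding f) (φ : T → X) (hφ : DenseRange φ) :
    weight X ≤ #T := by
  let g : X → ι → ℝ := fun x => f x
  have hg : IsInducing g := IsInducing.subtypeVal.comp hf.isInducing
  let J : Set ι := ⋃ t, Function.support (g (φ t))
  have hT : ℵ₀ ≤ #T := infinite_iff.1 inferInstance
  have hJ : #J ≤ #T := by
    refine (mk_iUnion_le_sum_mk).trans ((sum_le_sum _ (fun _ => ℵ₀) fun t => ?_).trans ?_)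
    · exact (f (φ t)).2.le_aleph0
    · simp
  -- A coordinate vanishing on a dense set vanishes everywhere, so the coordinates in `J` generate
  -- the topology.
  have hzero : ∀ a ∉ J, ∀ x, g x a = 0 := by
    intro a ha x
    have hcl : IsClosed {x | g x a = 0} :=
      isClosed_eq ((continuous_apply a).comp hg.continuous) continuous_const
    have : range φ ⊆ {x | g x a = 0} := by
      rintro _ ⟨t, rfl⟩
      by_contra h
      exact ha (mem_iUnion.2 ⟨t, h⟩)
    exact (hφ.closure_eq ▸ hcl.closure_subset_iff.2 this) (mem_univ x)
  let s : Set (Set X) := range fun p : J × countableBasis ℝ => {x | g x p.1 ∈ p.2.1}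
  have hs : ‹TopologicalSpace X› = generateFrom s := by
    apply le_antisymm
    · refine le_generateFrom ?_
      rintro _ ⟨p, rfl⟩
      exact ((isBasis_countableBasis ℝ).isOpen p.2.2).preimage
        ((continuous_apply p.1.1).comp hg.continuous)
    · rw [hg.eq_induced, ← continuous_iff_le_induced]
      refine @continuous_pi _ _ _ (generateFrom s) _ _ fun a => ?_
      by_cases ha : a ∈ J
      · refine @IsTopologicalBasis.continuous_iff _ _ (generateFrom s) _ _
          (isBasis_countableBasis ℝ) _ |>.2 fun V hV => ?_
        exact isOpen_generateFrom_of_mem ⟨(⟨a, ha⟩, ⟨V, hV⟩), rfl⟩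
      · have : (fun x => g x a) = fun _ => 0 := funext (hzero a ha)
        rw [this]
        exact @continuous_const _ _ (generateFrom s) _ _
  have hcard : #s ≤ #T := by
    refine mk_range_le.trans ?_
    rw [mk_prod]
    have h2 : lift.{u} #(countableBasis ℝ) ≤ ℵ₀ := by
      rw [lift_le_aleph0]
      exact (countable_countableBasis ℝ).le_aleph0
    exact (mul_le_mul' (by rwa [lift_uzero]) h2).trans (mul_eq_left hT hT aleph0_ne_zero).le
  have hB := isTopologicalBasis_of_subbasis hs
  refine (weight_le_mk hB).trans (mk_image_le.trans ?_)
  have hfin : #{F : Set (Set X) | F.Finite ∧ F ⊆ s} ≤ #(Finset s) := by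
    classical
    refine mk_le_of_injective (f := fun F => (F.2.1.preimage (f := ((↑) : s → Set X))
      Subtype.val_injective.injOn).toFinset) ?_
    intro F G h
    have h' : (Subtype.val ⁻¹' F.1 : Set s) = Subtype.val ⁻¹' G.1 := by simpa using h
    ext A
    refine ⟨fun hA => ?_, fun hA => ?_⟩
    · have : (⟨A, F.2.2 hA⟩ : s) ∈ (Subtype.val ⁻¹' G.1 : Set s) := by rw [← h']; exact hA
      exact this
    · have : (⟨A, G.2.2 hA⟩ : s) ∈ (Subtype.val ⁻¹' F.1 : Set s) := by rw [h']; exact hA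
      exact this
  refine hfin.trans ?_
  cases finite_or_infinite s
  · exact (lt_aleph0_of_finite _).le.trans hT
  · rwa [mk_finset_of_infinite]

/-- A disjoint family of non-empty open sets indexed by `I` witnesses `#I < ĉ`. -/
theorem mk_lt_cellularityHat {Z I : Type u} [TopologicalSpace Z] (W : I → Set Z)
    (ho : ∀ i, IsOpen (W i)) (hne : ∀ i, (W i).Nonempty) (hd : Pairwise (Function.onFun Disjoint W)) :
    #I < cellularityHat Z := by
  have hinj : Function.Injective W := by
    intro i j hij
    by_contra h
    have := hd h
    rw [Function.onFun, hij, disjoint_self] at this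
    exact (hne j).ne_empty this
  refine lt_of_not_ge fun hle => ?_
  have hmem := csInf_mem (exists_not_card_cellularFamily Z)
  apply hmem
  have h1 : sInf {κ : Cardinal.{u} | ¬ ∃ C : Set (Set Z), IsCellularFamily C ∧ #C = κ}
      ≤ #(range W) := by
    rw [mk_range_eq W hinj]; exact hle
  obtain ⟨C, hC, hCc⟩ := le_mk_iff_exists_subset.1 h1
  refine ⟨C, ⟨fun U hU => ?_, fun A hA B hB hAB => ?_⟩, hCc⟩
  · obtain ⟨i, rfl⟩ := hC hU
    exact ⟨ho i, hne i⟩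
  · obtain ⟨i, rfl⟩ := hC hA
    obtain ⟨j, rfl⟩ := hC hB
    exact hd fun h => hAB (congrArg W h)

theorem exists_isCellularFamily_of_lt_cellularityHat {Z : Type u} [TopologicalSpace Z]
    {κ : Cardinal.{u}} (h : κ < cellularityHat Z) :
    ∃ C : Set (Set Z), IsCellularFamily C ∧ #C = κ :=
  not_not.1 (notMem_of_lt_csInf h (OrderBot.bddBelow _))

theorem exists_isTopologicalBasis_mk_eq_weight (X : Type u) [TopologicalSpace X] :
    ∃ B : Set (Set X), IsTopologicalBasis B ∧ #B = weight X :=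
  csInf_mem (s := {κ : Cardinal.{u} | ∃ B : Set (Set X), IsTopologicalBasis B ∧ #B = κ})
    ⟨_, _, isTopologicalBasis_opens, rfl⟩

/-! ### Disjoint expansions and their refinements -/

/-- A set of points with a countable neighbourhood base, expanded to disjoint open sets with dense
union. -/
structure DisjointExpansion (Y : Type*) [TopologicalSpace Y] where
  carrier : Set Y
  nhd : Y → Set Y
  isCountablyGenerated : ∀ x ∈ carrier, (𝓝 x).IsCountablyGenerated
  isOpen : ∀ x ∈ carrier, IsOpen (nhd x)
  mem : ∀ x ∈ carrier, x ∈ nhd x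
  disjoint : carrier.PairwiseDisjoint nhd
  dense : Dense (⋃ x ∈ carrier, nhd x)

/-- Every collection of sets has a maximal pairwise disjoint subcollection. -/
theorem exists_maximal_pairwiseDisjoint {Y : Type*} (𝒲 : Set (Set Y)) :
    ∃ A ⊆ 𝒲, A.PairwiseDisjoint id ∧ ∀ W ∈ 𝒲, W.Nonempty → ∃ V ∈ A, (W ∩ V).Nonempty := by
  obtain ⟨A, hA⟩ := zorn_subset {A : Set (Set Y) | A ⊆ 𝒲 ∧ A.PairwiseDisjoint id} (by
    intro c hc hchain
    refine ⟨⋃₀ c, ⟨sUnion_subset fun A hA => (hc hA).1, ?_⟩, fun A hA => subset_sUnion_of_mem hA⟩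
    exact (pairwiseDisjoint_sUnion hchain.directedOn).2 fun A hA => (hc hA).2)
  refine ⟨A, hA.prop.1, hA.prop.2, fun W hW hne => ?_⟩
  by_contra! h
  have hins : insert W A ∈ {A : Set (Set Y) | A ⊆ 𝒲 ∧ A.PairwiseDisjoint id} := by
    refine ⟨insert_subset hW hA.prop.1, hA.prop.2.insert fun V hV _ => ?_⟩
    exact disjoint_iff_inter_eq_empty.2 (h V hV)
  have hWA : W ∈ A := hA.le_of_ge hins (subset_insert _ _) (mem_insert _ _)
  have := h W hWA
  rw [inter_self] at this
  exact hne.ne_empty this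

/-- A set lies inside or outside of every member of a collection. -/
def Decides {Y : Type*} (W : Set Y) (𝒬 : Set (Set Y)) : Prop :=
  ∀ P ∈ 𝒬, W ⊆ P ∨ Disjoint W P

/-- The open sets deciding finitely many disjoint families of open sets form a `π`-base. -/
theorem exists_isOpen_decides {Y : Type*} [TopologicalSpace Y] (P : ℕ → Set (Set Y))
    (ho : ∀ n, ∀ A ∈ P n, IsOpen A) (hd : ∀ n, (P n).PairwiseDisjoint id) (n : ℕ)
    {U : Set Y} (hU : IsOpen U) (hne : U.Nonempty) :
    ∃ V ⊆ U, IsOpen V ∧ V.Nonempty ∧ Decides V (⋃ i ≤ n, P i) := by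
  have key : ∀ n : ℕ, ∃ V ⊆ U, IsOpen V ∧ V.Nonempty ∧ ∀ i < n, Decides V (P i) := by
    intro n
    induction n with
    | zero => exact ⟨U, subset_rfl, hU, hne, by simp⟩
    | succ n ih =>
      obtain ⟨V, hVU, hVo, hVne, hV⟩ := ih
      -- Cutting down to one member of a disjoint family decides all its members; if none is met,
      -- nothing need be cut.
      by_cases h : ∃ A ∈ P n, (V ∩ A).Nonempty
      · obtain ⟨A, hA, hVA⟩ := h
        refine ⟨V ∩ A, inter_subset_left.trans hVU, hVo.inter (ho n A hA), hVA, fun i hi B hB => ?_⟩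
        rcases Nat.lt_succ_iff_lt_or_eq.1 hi with hi | rfl
        · exact (hV i hi B hB).imp inter_subset_left.trans fun h => h.mono_left inter_subset_left
        · by_cases hAB : A = B
          · exact Or.inl (hAB ▸ inter_subset_right)
          · exact Or.inr ((hd i hA hB hAB).mono_left inter_subset_right)
      · refine ⟨V, hVU, hVo, hVne, fun i hi B hB => ?_⟩
        rcases Nat.lt_succ_iff_lt_or_eq.1 hi with hi | rfl
        · exact hV i hi B hB
        · refine Or.inr (disjoint_iff_inter_eq_empty.2 ?_)
          by_contra hne'
          exact h ⟨B, hB, nonempty_iff_ne_empty.2 hne'⟩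
  obtain ⟨V, h1, h2, h3, h4⟩ := key (n + 1)
  refine ⟨V, h1, h2, h3, fun A hA => ?_⟩
  simp only [mem_iUnion] at hA
  obtain ⟨i, hi, hA⟩ := hA
  exact h4 i (Nat.lt_succ_of_le hi) A hA

namespace DisjointExpansion

variable {Y : Type*} [TopologicalSpace Y]

theorem exists_inter_nonempty (s : DisjointExpansion Y) {U : Set Y} (hU : IsOpen U)
    (hne : U.Nonempty) : ∃ x ∈ s.carrier, (U ∩ s.nhd x).Nonempty := by
  obtain ⟨z, hzU, hz⟩ := s.dense.inter_open_nonempty U hU hne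
  simp only [mem_iUnion] at hz
  obtain ⟨x, hx, hz⟩ := hz
  exact ⟨x, hx, z, hzU, hz⟩

theorem eq_of_mem (s : DisjointExpansion Y) {x y z : Y} (hx : x ∈ s.carrier) (hy : y ∈ s.carrier)
    (hzx : z ∈ s.nhd x) (hzy : z ∈ s.nhd y) : x = y :=
  s.disjoint.elim hx hy (not_disjoint_iff.2 ⟨z, hzx, hzy⟩)

/-- `t` refines `s`: the old points keep neighbourhoods, shrunk into those given by `O`, and the
neighbourhoods of the new points decide `𝒬`. -/
structure Refines (s t : DisjointExpansion Y) (O : Y → Set Y) (𝒬 : Set (Set Y)) : Prop where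
  subset : s.carrier ⊆ t.carrier
  nhd_subset : ∀ x ∈ s.carrier, t.nhd x ⊆ s.nhd x ∩ O x
  exists_subset : ∀ x ∈ t.carrier, ∃ y ∈ s.carrier, t.nhd x ⊆ s.nhd y
  decides : ∀ x ∈ t.carrier, x ∉ s.carrier → Decides (t.nhd x) 𝒬

/-- Shrinking the old neighbourhoods leaves gaps. A maximal disjoint family of deciding open sets in
the gaps, with a point of countable character chosen in each, restores density of the union. -/
theorem exists_refines [Nonempty Y]
    (hG : ∀ U : Set Y, IsOpen U → U.Nonempty → ∃ x ∈ U, (𝓝 x).IsCountablyGenerated)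
    (s : DisjointExpansion Y) (O : Y → Set Y) (hOo : ∀ x, IsOpen (O x)) (hOm : ∀ x, x ∈ O x)
    (𝒬 : Set (Set Y))
    (h𝒬 : ∀ U : Set Y, IsOpen U → U.Nonempty → ∃ V ⊆ U, IsOpen V ∧ V.Nonempty ∧ Decides V 𝒬) :
    ∃ t : DisjointExpansion Y, s.Refines t O 𝒬 := by
  classical
  obtain ⟨A, hA, hAd, hAmax⟩ := exists_maximal_pairwiseDisjoint
    {W : Set Y | IsOpen W ∧ W.Nonempty ∧ (∃ y ∈ s.carrier, W ⊆ s.nhd y) ∧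
      (∀ y ∈ s.carrier, Disjoint W (s.nhd y ∩ O y)) ∧ Decides W 𝒬}
  choose! pt hpt hptG using fun W (hW : W ∈ A) => hG W (hA hW).1 (hA hW).2.1
  -- For a new point the union has a single term, the member of `A` from which it was chosen.
  let N : Y → Set Y := fun x => if x ∈ s.carrier then s.nhd x ∩ O x else ⋃₀ {W ∈ A | x ∈ W}
  have hNold : ∀ x ∈ s.carrier, N x = s.nhd x ∩ O x := fun x hx => if_pos hx
  have hptn : ∀ W ∈ A, pt W ∉ s.carrier := fun W hW h =>
    disjoint_left.1 ((hA hW).2.2.2.1 _ h) (hpt W hW) ⟨s.mem _ h, hOm _⟩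
  have hNnew : ∀ W ∈ A, N (pt W) = W := by
    intro W hW
    have : {W' ∈ A | pt W ∈ W'} = {W} := by
      ext W'
      refine ⟨fun h => hAd.elim h.1 hW (not_disjoint_iff.2 ⟨pt W, h.2, hpt W hW⟩), ?_⟩
      rintro rfl
      exact ⟨hW, hpt _ hW⟩
    simp only [N, if_neg (hptn W hW), this, sUnion_singleton]
  refine ⟨⟨s.carrier ∪ pt '' A, N, ?_, ?_, ?_, ?_, ?_⟩, ?_⟩
  · rintro x (hx | ⟨W, hW, rfl⟩)
    · exact s.isCountablyGenerated x hx
    · exact hptG W hW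
  · rintro x (hx | ⟨W, hW, rfl⟩)
    · rw [hNold x hx]
      exact (s.isOpen x hx).inter (hOo x)
    · rw [hNnew W hW]
      exact (hA hW).1
  · rintro x (hx | ⟨W, hW, rfl⟩)
    · rw [hNold x hx]
      exact ⟨s.mem x hx, hOm x⟩
    · rw [hNnew W hW]
      exact hpt W hW
  · rintro x (hx | ⟨W, hW, rfl⟩) y (hy | ⟨V, hV, rfl⟩) hxy
    · rw [Function.onFun, hNold x hx, hNold y hy]
      exact (s.disjoint hx hy hxy).mono inter_subset_left inter_subset_left
    · rw [Function.onFun, hNold x hx, hNnew V hV]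
      exact ((hA hV).2.2.2.1 x hx).symm
    · rw [Function.onFun, hNold y hy, hNnew W hW]
      exact (hA hW).2.2.2.1 y hy
    · rw [Function.onFun, hNnew W hW, hNnew V hV]
      exact hAd hW hV fun h => hxy (congrArg pt h)
  · rw [dense_iff_inter_open]
    intro U hU hne
    obtain ⟨y, hy, hUy⟩ := s.exists_inter_nonempty hU hne
    by_cases h : ∃ z ∈ s.carrier, ((U ∩ s.nhd y) ∩ (s.nhd z ∩ O z)).Nonempty
    · obtain ⟨z, hz, w, hw, hwz⟩ := h
      exact ⟨w, hw.1, mem_biUnion (Or.inl hz) (by rwa [hNold z hz])⟩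
    · push Not at h
      obtain ⟨V, hVU, hVo, hVne, hV⟩ := h𝒬 _ (hU.inter (s.isOpen y hy)) hUy
      obtain ⟨W, hW, w, hwV, hwW⟩ := hAmax V ⟨hVo, hVne, ⟨y, hy, hVU.trans inter_subset_right⟩,
        fun z hz => (disjoint_iff_inter_eq_empty.2 (h z hz)).mono_left hVU, hV⟩ hVne
      exact ⟨w, (hVU hwV).1, mem_biUnion (Or.inr ⟨W, hW, rfl⟩) (by rwa [hNnew W hW])⟩
  · refine ⟨subset_union_left, fun x hx => (hNold x hx).subset, ?_, ?_⟩
    · rintro x (hx | ⟨W, hW, rfl⟩)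
      · exact ⟨x, hx, (hNold x hx).subset.trans inter_subset_left⟩
      · obtain ⟨y, hy, hWy⟩ := (hA hW).2.2.1
        exact ⟨y, hy, (hNnew W hW).subset.trans hWy⟩
    · rintro x (hx | ⟨W, hW, rfl⟩) hxn
      · exact absurd hx hxn
      · change Decides (N (pt W)) 𝒬
        rw [hNnew W hW]
        exact (hA hW).2.2.2.2

end DisjointExpansion

/-! ### Dense metrizable subspaces from `σ`-disjoint `π`-bases -/

/-- A `T₀` space whose topology is generated by countably many locally constant functions is
metrizable. -/
theorem metrizableSpace_of_isLocallyConstant {D E : Type*} [TopologicalSpace D] [T0Space D]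
    (ρ : D → ℕ → E) (hρ : ∀ n, IsLocallyConstant fun z => ρ z n)
    (h : ∀ z, ∀ U ∈ 𝓝 z, ∃ n, ∀ w, ρ w n = ρ z n → w ∈ U) : MetrizableSpace D := by
  let _ : TopologicalSpace E := ⊥
  have : DiscreteTopology E := ⟨rfl⟩
  have hind : IsInducing ρ := by
    rw [isInducing_iff_nhds]
    intro z
    refine le_antisymm ?_ fun U hU => ?_
    · rw [← map_le_iff_le_comap]
      exact (continuous_pi fun n => (hρ n).continuous).tendsto z
    · obtain ⟨n, hn⟩ := h z U hU
      have ho : IsOpen {g : ℕ → E | g n = ρ z n} :=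
        (isOpen_discrete {ρ z n}).preimage
          (continuous_apply n : Continuous fun g : ℕ → E => g n)
      exact ⟨_, ho.mem_nhds rfl, hn⟩
  exact hind.isEmbedding.metrizableSpace

/-- A regular `T₁` space whose points of countable character are dense and which has a
`σ`-disjoint `π`-base has a dense metrizable subspace. -/
theorem hasDenseMetrizableSubspace_of_sigmaDisjoint_piBase {Y : Type u} [TopologicalSpace Y]
    [T3Space Y]
    (hG : ∀ U : Set Y, IsOpen U → U.Nonempty → ∃ x ∈ U, (𝓝 x).IsCountablyGenerated)
    (P : ℕ → Set (Set Y)) (ho : ∀ n, ∀ A ∈ P n, IsOpen A) (hd : ∀ n, (P n).PairwiseDisjoint id)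
    (hP : ∀ U : Set Y, IsOpen U → U.Nonempty → ∃ n, ∃ A ∈ P n, A.Nonempty ∧ A ⊆ U) :
    HasDenseMetrizableSubspace Y := by
  rcases isEmpty_or_nonempty Y with hY | hY
  · exact ⟨univ, dense_univ, inferInstance⟩
  have hO : ∀ x : Y, ∃ O : ℕ → Set Y, (∀ n, IsOpen (O n)) ∧ (∀ n, x ∈ O n) ∧
      ((𝓝 x).IsCountablyGenerated → (𝓝 x).HasAntitoneBasis O) := by
    intro x
    by_cases h : (𝓝 x).IsCountablyGenerated
    · obtain ⟨O, hO, hb⟩ := (nhds_basis_opens x).exists_antitone_subbasis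
      exact ⟨O, fun n => (hO n).2, fun n => (hO n).1, fun _ => hb⟩
    · exact ⟨fun _ => univ, fun _ => isOpen_univ, fun _ => mem_univ x, fun h' => absurd h' h⟩
  choose O hOo hOm hOb using hO
  obtain ⟨x₀, -, hx₀⟩ := hG univ isOpen_univ univ_nonempty
  let s₀ : DisjointExpansion Y :=
    { carrier := {x₀}
      nhd := fun _ => univ
      isCountablyGenerated := by rintro x rfl; exact hx₀
      isOpen := fun _ _ => isOpen_univ
      mem := fun _ _ => mem_univ _
      disjoint := pairwiseDisjoint_singleton _ _
      dense := by simp }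
  choose next hnext using fun (n : ℕ) (s : DisjointExpansion Y) =>
    s.exists_refines hG (fun x => O x n) (fun x => hOo x n) (fun x => hOm x n) (⋃ i ≤ n, P i)
      (fun U hU hne => exists_isOpen_decides P ho hd n hU hne)
  let S : ℕ → DisjointExpansion Y := fun n => Nat.rec s₀ next n
  have hS : ∀ n, (S n).Refines (S (n + 1)) (fun x => O x n) (⋃ i ≤ n, P i) :=
    fun n => hnext n (S n)
  have hmono : Monotone fun n => (S n).carrier := monotone_nat_of_le_succ fun n => (hS n).subset
  -- The cells of each stage are only dense in `Y`, but they cover every point ever chosen, so they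
  -- partition `D`.
  have hcover : ∀ n k, ∀ z ∈ (S k).carrier, ∃ y ∈ (S n).carrier, z ∈ (S n).nhd y := by
    intro n k z hz
    rcases le_total k n with hkn | hnk
    · exact ⟨z, hmono hkn hz, (S n).mem z (hmono hkn hz)⟩
    · have key : ∀ k, n ≤ k → ∀ z ∈ (S k).carrier, ∃ y ∈ (S n).carrier,
          (S k).nhd z ⊆ (S n).nhd y := by
        intro k hk
        induction k, hk using Nat.le_induction with
        | base => exact fun z hz => ⟨z, hz, subset_rfl⟩
        | succ k hk ih =>
          intro z hz
          obtain ⟨w, hw, hzw⟩ := (hS k).exists_subset z hz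
          obtain ⟨y, hy, hwy⟩ := ih w hw
          exact ⟨y, hy, hzw.trans hwy⟩
      obtain ⟨y, hy, hzy⟩ := key k hnk z hz
      exact ⟨y, hy, hzy ((S k).mem z hz)⟩
  let D : Set Y := ⋃ n, (S n).carrier
  have hcoverD : ∀ (z : D) n, ∃ y ∈ (S n).carrier, (z : Y) ∈ (S n).nhd y := by
    intro z n
    obtain ⟨k, hk⟩ := mem_iUnion.1 z.2
    exact hcover n k z hk
  choose ρ hρ hρm using hcoverD
  have hDcg : ∀ z ∈ D, (𝓝 z).IsCountablyGenerated := by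
    intro z hz
    obtain ⟨k, hk⟩ := mem_iUnion.1 hz
    exact (S k).isCountablyGenerated z hk
  refine ⟨D, ?_, ?_⟩
  · rw [dense_iff_inter_open]
    intro U hU hne
    obtain ⟨x, hx⟩ := hne
    obtain ⟨C, hC, hCc, hCU⟩ := exists_mem_nhds_isClosed_subset (hU.mem_nhds hx)
    obtain ⟨n, A, hA, hAne, hAC⟩ := hP (interior C) isOpen_interior
      ⟨x, mem_interior_iff_mem_nhds.2 hC⟩
    by_contra hemp
    have hdisj : ∀ z ∈ D, z ∉ U := fun z hz hzU => hemp ⟨z, hzU, hz⟩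
    obtain ⟨y, hy, hyA⟩ := (S n).exists_inter_nonempty (ho n A hA) hAne
    -- A new cell meeting `A` would lie inside `A` and put its centre in `U`. So `A` meets only old
    -- cells, and `y` stays a limit of `A`.
    have key : ∀ m, n ≤ m → (A ∩ (S m).nhd y).Nonempty := by
      intro m hm
      induction m, hm using Nat.le_induction with
      | base => exact hyA
      | succ m hm ih =>
        have hym := hmono hm hy
        obtain ⟨w, hw, z, ⟨hzA, hzy⟩, hzw⟩ := (S (m + 1)).exists_inter_nonempty
          ((ho n A hA).inter ((S m).isOpen y hym)) ih
        by_cases hwm : w ∈ (S m).carrier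
        · have := (S m).eq_of_mem hym hwm hzy ((hS m).nhd_subset w hwm hzw).1
          exact ⟨z, hzA, by rwa [this]⟩
        · exfalso
          rcases (hS m).decides w hw hwm A (mem_biUnion hm hA) with h | h
          · exact hdisj w (mem_iUnion.2 ⟨m + 1, hw⟩)
              (hCU (interior_subset (hAC (h ((S (m + 1)).mem w hw)))))
          · exact disjoint_left.1 h hzw hzA
    have hyC : y ∈ closure C := by
      rw [mem_closure_iff_nhds_basis (hOb y ((S n).isCountablyGenerated y hy)).toHasBasis]
      intro i _
      obtain ⟨z, hzA, hz⟩ := key (max n i + 1) (by omega)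
      refine ⟨z, interior_subset (hAC hzA), ?_⟩
      exact (hOb y ((S n).isCountablyGenerated y hy)).antitone (le_max_right n i)
        ((hS (max n i)).nhd_subset y (hmono (le_max_left n i) hy) hz).2
    rw [hCc.closure_eq] at hyC
    exact hdisj y (mem_iUnion.2 ⟨n, hy⟩) (hCU hyC)
  · refine metrizableSpace_of_isLocallyConstant ρ (fun n => ?_) fun z U hU => ?_
    · rw [IsLocallyConstant.iff_exists_open]
      refine fun z => ⟨Subtype.val ⁻¹' (S n).nhd (ρ z n), ((S n).isOpen _ (hρ z n)).preimage
        continuous_subtype_val, hρm z n, fun w hw => ?_⟩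
      exact (S n).eq_of_mem (hρ w n) (hρ z n) (hρm w n) hw
    · have hb := hOb z (hDcg z z.2)
      rw [nhds_subtype] at hU
      obtain ⟨i, -, hi⟩ := (hb.toHasBasis.comap _).mem_iff.1 hU
      obtain ⟨k, hk⟩ := mem_iUnion.1 z.2
      have hzn : (z : Y) ∈ (S (max i k)).carrier := hmono (le_max_right i k) hk
      have hzn1 : (z : Y) ∈ (S (max i k + 1)).carrier := hmono (Nat.le_succ _) hzn
      -- Stage `max i k` already contains `z`; its neighbourhood shrinks into `O z (max i k)` one
      -- stage later.
      refine ⟨max i k + 1, fun w hw => hi ?_⟩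
      have hz : ρ z (max i k + 1) = z := (S (max i k + 1)).eq_of_mem (hρ z (max i k + 1)) hzn1
        (hρm z (max i k + 1)) ((S (max i k + 1)).mem z hzn1)
      have hwz : (w : Y) ∈ (S (max i k + 1)).nhd z := by
        have := hρm w (max i k + 1)
        rwa [hw, hz] at this
      exact hb.antitone (le_max_left i k) ((hS (max i k)).nhd_subset z hzn hwz).2

/-! ### Countable powers of Corson compacta -/

theorem IsCorsonCompactum.t2Space {X : Type u} [TopologicalSpace X] (hX : IsCorsonCompactum X) :
    T2Space X := by
  obtain ⟨-, ι, f, hf⟩ := hX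
  exact hf.t2Space

/-- The points of countable character are dense in a countable power of a Corson compactum. -/
theorem IsCorsonCompactum.exists_isCountablyGenerated_nhds {X : Type u} [TopologicalSpace X]
    (hX : IsCorsonCompactum X) {U : Set (ℕ → X)} (hU : IsOpen U) (hne : U.Nonempty) :
    ∃ x ∈ U, (𝓝 x).IsCountablyGenerated := by
  have := hX.t2Space
  obtain ⟨_, ι, f, hf⟩ := hX
  refine exists_isCountablyGenerated_nhds_of_sigmaProduct
    (fun (y : ℕ → X) (p : ℕ × ι) => (f (y p.1) : ι → ℝ) p.2) ?_ ?_ ?_ hU hne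
  · exact continuous_pi fun p => (continuous_apply p.2).comp
      (continuous_subtype_val.comp (hf.continuous.comp (continuous_apply p.1)))
  · intro x y h
    ext n
    refine hf.injective (Subtype.ext (funext fun a => ?_))
    exact congrFun h (n, a)
  · intro y
    have : (⋃ n : ℕ, Prod.mk n '' Function.support (f (y n) : ι → ℝ)).Countable :=
      countable_iUnion fun n => (f (y n)).2.image _
    refine this.mono ?_
    rintro ⟨n, a⟩ h
    exact mem_iUnion.2 ⟨n, a, h, rfl⟩

/-- If `X ^ ω` has a dense metrizable subspace, then it has a cellular family of size `w(X)`. -/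
theorem IsCorsonCompactum.weight_lt_cellularityHat {X : Type u} [TopologicalSpace X]
    (hX : IsCorsonCompactum X) (hD : HasDenseMetrizableSubspace (ℕ → X)) :
    weight X < cellularityHat (ℕ → X) := by
  have := hX.t2Space
  cases finite_or_infinite X
  · have hB : IsTopologicalBasis (range fun x : X => ({x} : Set X)) :=
      isTopologicalBasis_of_isOpen_of_nhds (by rintro _ ⟨x, rfl⟩; exact isOpen_discrete _)
        fun x U hx _ => ⟨{x}, ⟨x, rfl⟩, rfl, singleton_subset_iff.2 hx⟩
    refine ((weight_le_mk hB).trans mk_range_le).trans_lt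
      (mk_lt_cellularityHat (fun x : X => {y : ℕ → X | y 0 = x}) (fun x => ?_)
        (fun x => ⟨fun _ => x, rfl⟩) fun x y hxy => ?_)
    · exact (isOpen_discrete {x}).preimage (continuous_apply 0 : Continuous fun y : ℕ → X => y 0)
    · exact disjoint_left.2 fun z hz hz' => hxy (hz.symm.trans hz')
  obtain ⟨D, hDd, hDm⟩ := hD
  let _ := metrizableSpaceMetric D
  have hsep : ∀ n : ℕ, ∃ A : Set D, (A.Pairwise fun x y => (1 : ℝ) / (n + 1) ≤ dist x y) ∧
      ∀ z, ∃ a ∈ A, dist z a < 1 / (n + 1) := by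
    intro n
    have hpos : (0 : ℝ) < 1 / (n + 1) := Nat.one_div_pos_of_nat
    obtain ⟨A, hA⟩ := zorn_subset {A : Set D | A.Pairwise fun x y => (1 : ℝ) / (n + 1) ≤ dist x y}
      fun c hc hchain => ⟨⋃₀ c, (pairwise_sUnion hchain.directedOn).2 fun A hA => hc hA,
        fun A hA => subset_sUnion_of_mem hA⟩
    refine ⟨A, hA.prop, fun z => ?_⟩
    by_contra! h
    have hz : z ∈ A := hA.le_of_ge (y := insert z A)
      (hA.prop.insert fun b hb _ => ⟨h b hb, by rw [dist_comm]; exact h b hb⟩)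
      (subset_insert _ _) (mem_insert _ _)
    have := h z hz
    rw [dist_self] at this
    exact absurd this hpos.not_ge
  choose A hAsep hAcov using hsep
  let T : Type u := Σ n, A n
  have hdense : DenseRange fun t : T => (t.2 : D) := by
    rw [Metric.denseRange_iff]
    intro z r hr
    obtain ⟨n, hn⟩ := exists_nat_one_div_lt hr
    obtain ⟨a, ha, hza⟩ := hAcov n z
    exact ⟨⟨n, a, ha⟩, hza.trans hn⟩
  have hdense' : DenseRange fun t : T => ((t.2 : D) : ℕ → X) 0 :=
    (Function.surjective_eval 0).denseRange.comp
      (hDd.denseRange_val.comp hdense continuous_subtype_val) (continuous_apply 0)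
  have hT : Infinite T := by
    by_contra hfin
    rw [not_infinite_iff_finite] at hfin
    have := (finite_range fun t : T => ((t.2 : D) : ℕ → X) 0).isClosed.closure_eq
    rw [hdense'.closure_range] at this
    exact infinite_univ (this ▸ finite_range _)
  obtain ⟨-, ι, f, hf⟩ := hX
  refine (weight_le_of_denseRange f hf _ hdense').trans_lt ?_
  -- Coordinate `0` in `U n` separates different scales `n`; the balls are moved to the later
  -- coordinates.
  obtain ⟨U, hUi, hUo, hUd⟩ := exists_seq_infinite_isOpen_pairwise_disjoint X
  have hV : ∀ t : T, ∃ V : Set (ℕ → X), IsOpen V ∧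
      (↑) ⁻¹' V = Metric.ball (t.2 : D) (1 / (t.1 + 1) / 2) := fun t =>
    isOpen_induced_iff.1 Metric.isOpen_ball
  choose V hVo hVb using hV
  refine mk_lt_cellularityHat
    (fun t : T => {y : ℕ → X | y 0 ∈ U t.1 ∧ (fun k => y (k + 1)) ∈ V t}) (fun t => ?_)
    (fun t => ?_) ?_
  · exact ((hUo t.1).preimage (continuous_apply 0)).inter
      ((hVo t).preimage (continuous_pi fun k => continuous_apply (k + 1)))
  · obtain ⟨x, hx⟩ := (hUi t.1).nonempty
    have ht : (t.2 : D) ∈ ((↑) ⁻¹' V t : Set D) := by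
      rw [hVb]
      exact Metric.mem_ball_self (half_pos Nat.one_div_pos_of_nat)
    exact ⟨fun k => Nat.casesOn (motive := fun _ => X) k x ((t.2 : D) : ℕ → X), hx, ht⟩
  · rintro ⟨n, a⟩ ⟨m, b⟩ hne
    by_cases hnm : n = m
    · subst hnm
      have hab : (a : D) ≠ b := fun h => hne (by rw [Subtype.ext h])
      have hVd : Disjoint (V ⟨n, a⟩) (V ⟨n, b⟩) := by
        rw [disjoint_iff_inter_eq_empty]
        by_contra hne'
        obtain ⟨z, hz, hzD⟩ := hDd.inter_open_nonempty _ ((hVo ⟨n, a⟩).inter (hVo ⟨n, b⟩))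
          (nonempty_iff_ne_empty.2 hne')
        have h1 : (⟨z, hzD⟩ : D) ∈ ((↑) ⁻¹' V ⟨n, a⟩ : Set D) := hz.1
        have h2 : (⟨z, hzD⟩ : D) ∈ ((↑) ⁻¹' V ⟨n, b⟩ : Set D) := hz.2
        rw [hVb, Metric.mem_ball] at h1 h2
        have h3 := hAsep n a.2 b.2 hab
        have h4 := dist_triangle_left (a : D) b ⟨z, hzD⟩
        dsimp only at h1 h2
        linarith
      exact disjoint_left.2 fun y h1 h2 => disjoint_left.1 hVd h1.2 h2.2
    · exact disjoint_left.2 fun y h1 h2 => disjoint_left.1 (hUd hnm) h1.1 h2.1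

/-- If `X ^ ω` has a cellular family of infinite size `w(X)`, then it has a `σ`-disjoint `π`-base. -/
theorem exists_sigmaDisjoint_piBase {X : Type u} [TopologicalSpace X]
    {B : Set (Set X)} (hB : IsTopologicalBasis B) (hBinf : ℵ₀ ≤ #B)
    {C : Set (Set (ℕ → X))} (hC : IsCellularFamily C) (hCB : #C = #B) :
    ∃ P : ℕ → Set (Set (ℕ → X)), (∀ n, ∀ A ∈ P n, IsOpen A) ∧
      (∀ n, (P n).PairwiseDisjoint id) ∧
      ∀ U : Set (ℕ → X), IsOpen U → U.Nonempty → ∃ n, ∃ A ∈ P n, A.Nonempty ∧ A ⊆ U := by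
  -- Infinite `#B` gives `#B ^ n ≤ #B`, so each length `n` can reuse all of `C` as labels.
  have he : ∀ n : ℕ, Nonempty ((Fin n → B) ↪ C) := by
    intro n
    rw [← Cardinal.le_def, hCB, mk_arrow]
    simpa using power_nat_le hBinf
  let e : ∀ n, (Fin n → B) ↪ C := fun n => (he n).some
  let W : ∀ n, (Fin n → B) → Set (ℕ → X) := fun n b =>
    {y | (∀ i, y i ∈ (b i : Set X)) ∧ (fun k => y (k + n)) ∈ (e n b : Set (ℕ → X))}
  refine ⟨fun n => range (W n), ?_, ?_, ?_⟩
  · rintro n _ ⟨b, rfl⟩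
    refine IsOpen.inter ?_ ((hC.1 _ (e n b).2).1.preimage
      (continuous_pi fun k => continuous_apply (k + n)))
    change IsOpen {y : ℕ → X | ∀ i : Fin n, y i ∈ (b i : Set X)}
    rw [ofPred_forall]
    exact isOpen_iInter_of_finite fun i => (hB.isOpen (b i).2).preimage (continuous_apply _)
  · rintro n _ ⟨b, rfl⟩ _ ⟨b', rfl⟩ hne
    have hbb : (e n b : Set (ℕ → X)) ≠ e n b' := fun h =>
      hne (congrArg (W n) ((e n).injective (Subtype.ext h)))
    exact disjoint_left.2 fun y h1 h2 =>
      disjoint_left.1 (hC.2 (e n b).2 (e n b').2 hbb) h1.2 h2.2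
  · rintro U hU ⟨x, hx⟩
    obtain ⟨I, u, hu, hIU⟩ := isOpen_pi_iff.1 hU x hx
    have hb : ∀ i, ∃ b ∈ B, x i ∈ b ∧ (i ∈ I → b ⊆ u i) := by
      intro i
      by_cases hi : i ∈ I
      · obtain ⟨b, hbB, hxb, hbu⟩ := hB.exists_subset_of_mem_open (hu i hi).2 (hu i hi).1
        exact ⟨b, hbB, hxb, fun _ => hbu⟩
      · obtain ⟨b, hbB, hxb, -⟩ := hB.exists_subset_of_mem_open (mem_univ (x i)) isOpen_univ
        exact ⟨b, hbB, hxb, fun h => absurd h hi⟩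
    choose b hbB hxb hbu using hb
    obtain ⟨n, hn⟩ := I.exists_nat_subset_range
    let b' : Fin n → B := fun i => ⟨b i, hbB i⟩
    refine ⟨n, W n b', ⟨b', rfl⟩, ?_, fun y hy => hIU fun i hi => ?_⟩
    · obtain ⟨z, hz⟩ := (hC.1 _ (e n b').2).2
      refine ⟨fun k => if k < n then x k else z (k - n), fun i => ?_, ?_⟩
      · simpa [i.2, b'] using hxb i
      · simpa using hz
    · exact hbu i hi (hy.1 ⟨i, Finset.mem_range.1 (hn hi)⟩)

theorem mainTheorem1 (X : Type u) [TopologicalSpace X] (hX : IsCorsonCompactum X) :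
    HasDenseMetrizableSubspace (ℕ → X) ↔ weight X < cellularityHat (ℕ → X) := by
  refine ⟨hX.weight_lt_cellularityHat, fun h => ?_⟩
  have := hX.t2Space
  have := hX.1
  obtain ⟨B, hB, hBw⟩ := exists_isTopologicalBasis_mk_eq_weight X
  rcases le_or_gt ℵ₀ #B with hinf | hfin
  · obtain ⟨C, hC, hCw⟩ := exists_isCellularFamily_of_lt_cellularityHat h
    obtain ⟨P, ho, hd, hP⟩ := exists_sigmaDisjoint_piBase hB hinf hC (hCw.trans hBw.symm)
    exact hasDenseMetrizableSubspace_of_sigmaDisjoint_piBase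
      (fun U hU hne => hX.exists_isCountablyGenerated_nhds hU hne) P ho hd hP
  -- With a finite base, `X^ω` itself is metrizable.
  · have : SecondCountableTopology X := hB.secondCountableTopology (le_aleph0_iff_set_countable.1
      hfin.le)
    exact ⟨univ, dense_univ, inferInstance⟩
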